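/- \textbf{Theorem (Measure concentration in projective space).} For $d\ge 1$ let $|\psi\rangle,|\varphi\rangle$ be independent Haar-random pure states of a complex Hilbert space $\mathcal H$ of dimension $d$, i.e. independent random elements of the projective space $\mathcal P(\mathcal H)$, each distributed according to the Borel probability measure on $\mathcal P(\mathcal H)$ that is invariant under all unitary operators. Let $$r=\frac{|\langle\psi|\varphi\rangle|}{\|\psi\|\,\|\varphi\|}\in[0,1],\qquad d_{\mathrm{FS}}=d_{\mathrm{FS}}(|\psi\rangle,|\varphi\rangle)=\arccos r$$ be their overlap and their Fubini--Study distance. Then: (i) For every $d\ge 1$, $$\mathbb E[r]=\frac{\Gamma(3/2)\,\Gamma(d)}{\Gamma(d+1/2)},\qquad\text{and}\qquad \mathbb E[r]=\frac{\sqrt{\pi}}{2\sqrt d}+O(d^{-3/2})\quad(d\to\infty).$$ In particular the constant $\sqrt\pi/2$ cannot be replaced by $\pi/4$: for every $C$ one has $\bigl|\mathbb E[r]-\frac{\pi}{4\sqrt d}\bigr|>C\,d^{-3/2}$ for all sufficiently large $d$. (ii) For every $d\ge 2$ the random variable $r^2$ has the $\mathrm{Beta}(1,d-1)$ distribution. There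 is a universal constant $c>0$ such that for all $d\ge1$ and all $\epsilon>0$ $$\Pr\bigl(|d_{\mathrm{FS}}-\pi/2|>\epsilon\bigr)\le 2\exp(-c\,d\,\epsilon^2).$$ (iii) Random states are almost orthogonal in high dimension: $r=O(d^{-1/2})$ in probability, i.e. for every $\delta>0$ there is $C>0$ with $\Pr(r>C d^{-1/2})\le\delta$ for all $d\ge1$; and $d_{\mathrm{FS}}\to\pi/2$ in probability, i.e. for all $\epsilon,\delta>0$ one has $\Pr(|d_{\mathrm{FS}}-\pi/2|>\epsilon)\le\delta$ for all sufficiently large $d$. -/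

import Mathlib

open MeasureTheory ProbabilityTheory
open scoped LinearAlgebra.Projectivization

universe u v

namespace PureState

section Rays

variable {H : Type*} [NormedAddCommGroup H] [InnerProductSpace ℂ H]

/-- The projective Hilbert space carries the quotient topology of `H \ {0}`. -/
noncomputable instance instTopologicalSpaceRay : TopologicalSpace (ℙ ℂ H) :=
  TopologicalSpace.coinduced (Projectivization.mk' ℂ (V := H)) inferInstance

/-- The projective Hilbert space carries its Borel sigma-algebra. -/
noncomputable instance instMeasurableSpaceRay : MeasurableSpace (ℙ ℂ H) := borel _

instance instBorelSpaceRay : BorelSpace (ℙ ℂ H) := ⟨rfl⟩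

/-- The action of a unitary operator on pure states, `[ψ] ↦ [U ψ]`. -/
noncomputable def rayMap (U : H ≃ₗᵢ[ℂ] H) : ℙ ℂ H → ℙ ℂ H :=
  Projectivization.map (U.toLinearEquiv : H →ₗ[ℂ] H) U.injective

/-- The overlap `|⟨ψ|φ⟩| / (‖ψ‖ ‖φ‖)` of the pure states `[ψ]` and `[φ]`. -/
noncomputable def overlap (p q : ℙ ℂ H) : ℝ :=
  ‖inner ℂ p.rep q.rep‖ / (‖p.rep‖ * ‖q.rep‖)

/-- The Fubini–Study distance `arccos (|⟨ψ|φ⟩| / (‖ψ‖ ‖φ‖))`. -/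
noncomputable def dFS (p q : ℙ ℂ H) : ℝ :=
  Real.arccos (overlap p q)

/-- The overlap does not depend on the representatives. -/
theorem overlap_mk (v w : H) (hv : v ≠ 0) (hw : w ≠ 0) :
    overlap (Projectivization.mk ℂ v hv) (Projectivization.mk ℂ w hw) =
      ‖inner ℂ v w‖ / (‖v‖ * ‖w‖) := by
  obtain ⟨a, ha⟩ := Projectivization.exists_smul_eq_mk_rep ℂ v hv
  obtain ⟨b, hb⟩ := Projectivization.exists_smul_eq_mk_rep ℂ w hw
  have ha0 : ‖(a : ℂ)‖ ≠ 0 := norm_ne_zero_iff.2 a.ne_zero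
  have hb0 : ‖(b : ℂ)‖ ≠ 0 := norm_ne_zero_iff.2 b.ne_zero
  have hv0 : ‖v‖ ≠ 0 := norm_ne_zero_iff.2 hv
  have hw0 : ‖w‖ ≠ 0 := norm_ne_zero_iff.2 hw
  rw [overlap, ← ha, ← hb, Units.smul_def, Units.smul_def, inner_smul_left, inner_smul_right,
    norm_mul, norm_mul, norm_smul, norm_smul, RCLike.norm_conj]
  field_simp

theorem continuous_mk' : Continuous (Projectivization.mk' ℂ (V := H)) :=
  continuous_coinduced_rng

theorem continuous_rayMap (U : H ≃ₗᵢ[ℂ] H) : Continuous (rayMap U) := by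
  refine continuous_coinduced_dom.2 ?_
  have h : Continuous fun v : {v : H // v ≠ 0} =>
      (⟨U v, fun h => v.2 (U.injective (by simpa using h))⟩ : {v : H // v ≠ 0}) := by
    fun_prop
  exact continuous_mk'.comp h

/-- A Borel measure on the projective Hilbert space is *Haar* if it is a probability measure that
is invariant under all unitary operators. -/
def IsHaarState (μ : Measure (ℙ ℂ H)) : Prop :=
  IsProbabilityMeasure μ ∧ ∀ U : H ≃ₗᵢ[ℂ] H, μ.map (rayMap U) = μ

/-- A Haar measure exists on the pure states of every nonzero finite-dimensional Hilbert space. -/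
theorem exists_isHaarState [FiniteDimensional ℂ H] [Nontrivial H] :
    ∃ μ : Measure (ℙ ℂ H), IsHaarState μ := by
  let _ : MeasurableSpace H := borel H
  have : BorelSpace H := ⟨rfl⟩
  let _ : InnerProductSpace ℝ H := InnerProductSpace.complexToReal
  have : FiniteDimensional ℝ H := FiniteDimensional.complexToReal H
  let ν : Measure H := ProbabilityTheory.cond volume (Metric.ball (0 : H) 1)
  have hν : IsProbabilityMeasure ν :=
    ProbabilityTheory.cond_isProbabilityMeasure_of_finite
      (Metric.isOpen_ball.measure_pos _ ⟨0, by simp⟩).ne' measure_ball_lt_top.ne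
  have hν0 : ν {0} = 0 :=
    ProbabilityTheory.cond_absolutelyContinuous (measure_singleton 0)
  have hemb : MeasurableEmbedding (Subtype.val : {v : H // v ≠ 0} → H) :=
    MeasurableEmbedding.subtype_coe (measurableSet_singleton (0 : H)).compl
  have hmk : Measurable (Projectivization.mk' ℂ (V := H)) := continuous_mk'.measurable
  refine ⟨(ν.comap Subtype.val).map (Projectivization.mk' ℂ), ⟨?_⟩, fun U => ?_⟩
  · rw [Measure.map_apply hmk .univ, hemb.comap_apply, Set.preimage_univ, Set.image_univ,
      Subtype.range_coe_subtype]
    exact (prob_compl_eq_one_iff (measurableSet_singleton (0 : H))).2 hν0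
  · ext B hB
    have hU : Measurable (rayMap U) := (continuous_rayMap U).measurable
    rw [Measure.map_apply hU hB, Measure.map_apply hmk (hU hB), Measure.map_apply hmk hB,
      hemb.comap_apply, hemb.comap_apply]
    have hset : (Subtype.val '' (Projectivization.mk' ℂ (V := H) ⁻¹' (rayMap U ⁻¹' B)) : Set H) =
        U ⁻¹' (Subtype.val '' (Projectivization.mk' ℂ (V := H) ⁻¹' B)) := by
      ext v
      constructor
      · rintro ⟨w, hw, rfl⟩
        exact ⟨⟨U w, fun h => w.2 (U.injective (by simpa using h))⟩, hw, rfl⟩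
      · rintro ⟨w, hw, hwv⟩
        have hv : v ≠ 0 := by
          rintro rfl
          exact w.2 (by simpa using hwv)
        refine ⟨⟨v, hv⟩, ?_, rfl⟩
        have : w = ⟨U v, fun h => hv (U.injective (by simpa using h))⟩ := Subtype.ext hwv
        rw [this] at hw
        exact hw
    have hms : MeasurableSet (Subtype.val '' (Projectivization.mk' ℂ (V := H) ⁻¹' B)) :=
      hemb.measurableSet_image.2 (hmk hB)
    let U' : H ≃ₗᵢ[ℝ] H := { U.toLinearEquiv.restrictScalars ℝ with norm_map' := U.norm_map }
    have hvol : MeasurePreserving (U : H → H) volume volume := U'.measurePreserving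
    have hball : (U : H → H) ⁻¹' Metric.ball 0 1 = Metric.ball 0 1 := by
      ext v
      simp
    rw [hset]
    simp only [ν]
    rw [ProbabilityTheory.cond_apply measurableSet_ball,
      ProbabilityTheory.cond_apply measurableSet_ball]
    congr 1
    conv_lhs => rw [← hball, ← Set.preimage_inter]
    exact hvol.measure_preimage (measurableSet_ball.inter hms).nullMeasurableSet

end Rays

/-- Two independent Haar-random pure states of a complex Hilbert space of dimension `d`, on an
arbitrary probability space. -/
structure IndepHaarPair (d : ℕ) where
  /-- the Hilbert space -/
  H : Type u
  [normedAddCommGroup : NormedAddCommGroup H]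
  [innerProductSpace : InnerProductSpace ℂ H]
  finrank_eq : Module.finrank ℂ H = d
  /-- the sample space -/
  Ω : Type v
  [measurableSpace : MeasurableSpace Ω]
  /-- the probability measure -/
  P : Measure Ω
  [isProbabilityMeasure : IsProbabilityMeasure P]
  /-- the first random state -/
  ψ : Ω → ℙ ℂ H
  /-- the second random state -/
  φ : Ω → ℙ ℂ H
  aemeasurable_fst : AEMeasurable ψ P
  aemeasurable_snd : AEMeasurable φ P
  haar_fst : IsHaarState (P.map ψ)
  haar_snd : IsHaarState (P.map φ)
  indep : IndepFun ψ φ P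

attribute [instance] IndepHaarPair.normedAddCommGroup IndepHaarPair.innerProductSpace
  IndepHaarPair.measurableSpace IndepHaarPair.isProbabilityMeasure

namespace IndepHaarPair

variable {d : ℕ}

/-- The random overlap `r = |⟨ψ|φ⟩|`. -/
noncomputable def r (S : IndepHaarPair.{u, v} d) (ω : S.Ω) : ℝ :=
  overlap (S.ψ ω) (S.φ ω)

/-- The random Fubini–Study distance of the two states. -/
noncomputable def dist (S : IndepHaarPair.{u, v} d) (ω : S.Ω) : ℝ :=
  dFS (S.ψ ω) (S.φ ω)

/-- Independent Haar-random pairs exist in every dimension `d ≥ 1`. -/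
theorem nonempty (hd : 1 ≤ d) : Nonempty (IndepHaarPair.{u, u} d) := by
  have : Nonempty (ULift.{u} (Fin d)) := ⟨⟨⟨0, hd⟩⟩⟩
  obtain ⟨μ, hμ⟩ := exists_isHaarState (H := EuclideanSpace ℂ (ULift.{u} (Fin d)))
  have := hμ.1
  exact ⟨{
    H := EuclideanSpace ℂ (ULift.{u} (Fin d))
    finrank_eq := by simp
    Ω := (ℙ ℂ (EuclideanSpace ℂ (ULift.{u} (Fin d)))) × (ℙ ℂ (EuclideanSpace ℂ (ULift.{u} (Fin d))))
    P := μ.prod μ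
    ψ := Prod.fst
    φ := Prod.snd
    aemeasurable_fst := measurable_fst.aemeasurable
    aemeasurable_snd := measurable_snd.aemeasurable
    haar_fst := by rw [Measure.map_fst_prod]; simpa using hμ
    haar_snd := by rw [Measure.map_snd_prod]; simpa using hμ
    indep := indepFun_prod (X := id) (Y := id) measurable_id measurable_id }⟩

end IndepHaarPair

end PureState

/-! Everything rests on one tail formula: in dimension `d` the squared overlap exceeds `t ∈ [0,1)`
with probability `(1-t)^(d-1)`. For a standard complex Gaussian vector and a fixed ray `q`, take
coordinates in an orthonormal basis starting on `q`. The event becomes a cone on which the first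
coordinate dominates, and integrating that coordinate out rescales the Gaussian in the other `d-1`
coordinates, which produces the factor (`lintegral_gaussian_cone`).

An arbitrary Haar state `μ` need not be identified with the law `γ` of the Gaussian ray. The `γ × μ`
mass of `{overlap² > t}` is computed in two orders: for fixed `p` the `μ`-tail does not depend on
`p`, by invariance and transitivity of the unitary action; for fixed `q` the `γ`-tail is explicit.
Comparison gives `IsHaarState.measure_overlap_tail`, and independence carries it over to the random
pair.

This tail is that of `Beta(1, d-1)`. The mean of its square root is a ratio of Beta functions, and
log-convexity of Γ places `Γ(d)/Γ(d+1/2)` between `1/√d` and `1/√(d-1/2)`. Concentration follows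
from `|d_FS - π/2| = arcsin r`, `sin ε ≥ 2ε/π` and `1 - x ≤ exp(-x)`; almost orthogonality is then a
corollary. -/

open Set Filter Topology
open scoped ENNReal

/-! ### Gaussian integrals over discs and cones -/

/-- The Gaussian mass of the exterior of a disc in the plane. -/
theorem lintegral_gaussian_exterior_disc {a c : ℝ} (ha : 0 < a) (hc : 0 ≤ c) :
    ∫⁻ z : ℂ, {z : ℂ | c < ‖z‖ ^ 2}.indicator
      (fun z => ENNReal.ofReal (Real.exp (-a * ‖z‖ ^ 2))) z =
      ENNReal.ofReal (Real.pi / a * Real.exp (-a * c)) := by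
  rw [← Complex.lintegral_comp_polarCoord_symm, polarCoord_target]
  -- The trailing factor `1` is the angular part, exhibiting the integrand as a product for
  -- `lintegral_prod_mul`.
  have h1 : ∀ p ∈ Ioi (0 : ℝ) ×ˢ Ioo (-Real.pi) Real.pi,
      ENNReal.ofReal p.1 • {z : ℂ | c < ‖z‖ ^ 2}.indicator
        (fun z => ENNReal.ofReal (Real.exp (-a * ‖z‖ ^ 2))) (Complex.polarCoord.symm p) =
      (Ioi (Real.sqrt c)).indicator
        (fun r => ENNReal.ofReal (r * Real.exp (-a * r ^ 2))) p.1 * 1 := by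
    rintro ⟨r, θ⟩ ⟨hr, -⟩
    have hr' : 0 < r := hr
    have hn : ‖Complex.polarCoord.symm (r, θ)‖ = r := by
      rw [Complex.norm_polarCoord_symm, abs_of_pos hr']
    by_cases h : c < r ^ 2
    · rw [indicator_of_mem (by simpa [hn] using h),
        indicator_of_mem (by simpa using (Real.sqrt_lt' hr').2 h), hn, mul_one, smul_eq_mul,
        ENNReal.ofReal_mul hr'.le]
    · rw [indicator_of_notMem (by simpa [hn] using h),
        indicator_of_notMem (by simpa [Real.sqrt_lt' hr'] using h)]
      simp
  rw [setLIntegral_congr_fun (measurableSet_Ioi.prod measurableSet_Ioo) h1, Measure.volume_eq_prod,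
    ← Measure.prod_restrict, lintegral_prod_mul (f := (Ioi (Real.sqrt c)).indicator
        (fun r => ENNReal.ofReal (r * Real.exp (-a * r ^ 2)))) (g := fun _ => 1)
        ((Measurable.indicator (by fun_prop) measurableSet_Ioi).aemeasurable) (by fun_prop),
    lintegral_indicator measurableSet_Ioi, Measure.restrict_restrict measurableSet_Ioi,
    inter_eq_left.2 (Ioi_subset_Ioi (Real.sqrt_nonneg c))]
  have hderiv : ∀ x ∈ Ici (Real.sqrt c), HasDerivAt (fun r => -(1 / (2 * a)) * Real.exp (-a * r ^ 2))
      (x * Real.exp (-a * x ^ 2)) x := by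
    intro x _
    have := (((hasDerivAt_pow 2 x).const_mul (-a)).exp).const_mul (-(1 / (2 * a)))
    refine this.congr_deriv ?_
    simp only [Nat.cast_ofNat, Nat.add_one_sub_one, pow_one]
    field_simp
  have hpos : ∀ x ∈ Ioi (Real.sqrt c), 0 ≤ x * Real.exp (-a * x ^ 2) := fun x hx =>
    mul_nonneg ((Real.sqrt_nonneg c).trans (le_of_lt hx)) (Real.exp_pos _).le
  have hlim : Tendsto (fun r : ℝ => -(1 / (2 * a)) * Real.exp (-a * r ^ 2)) atTop
      (𝓝 (-(1 / (2 * a)) * 0)) := by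
    refine (Real.tendsto_exp_atBot.comp ?_).const_mul _
    exact (tendsto_pow_atTop two_ne_zero).const_mul_atTop_of_neg (by linarith)
  have hint := integrableOn_Ioi_deriv_of_nonneg' hderiv hpos hlim
  rw [← ofReal_integral_eq_lintegral_ofReal hint
    ((ae_restrict_iff' measurableSet_Ioi).2 (ae_of_all _ hpos)),
    integral_Ioi_of_hasDerivAt_of_tendsto' hderiv hint hlim, Real.sq_sqrt hc]
  simp only [lintegral_const, Measure.restrict_apply_univ, Real.volume_Ioo, one_mul]
  rw [← ENNReal.ofReal_mul]
  · congr 1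
    field_simp
    ring
  · have := Real.exp_pos (-a * c)
    simp only [mul_zero, zero_sub, neg_mul, neg_neg]
    positivity

theorem lintegral_gaussian_complex {a : ℝ} (ha : 0 < a) :
    ∫⁻ z : ℂ, ENNReal.ofReal (Real.exp (-a * ‖z‖ ^ 2)) = ENNReal.ofReal (Real.pi / a) := by
  have h := lintegral_gaussian_exterior_disc ha le_rfl
  rw [lintegral_indicator (measurableSet_lt (by fun_prop) (by fun_prop))] at h
  rw [← setLIntegral_univ, ← setLIntegral_congr (s := {z : ℂ | 0 < ‖z‖ ^ 2}), h]
  · simp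
  · rw [ae_eq_univ]
    refine measure_mono_null (t := {0}) ?_ (measure_singleton _)
    intro z hz
    simpa using hz

theorem lintegral_fin_succ {n : ℕ} {F : (Fin (n + 1) → ℂ) → ℝ≥0∞} (hF : Measurable F) :
    ∫⁻ z, F z = ∫⁻ w : Fin n → ℂ, ∫⁻ z : ℂ, F (Fin.cons z w) := by
  have e := (volume_preserving_piFinSuccAbove (fun _ : Fin (n + 1) => ℂ) 0).symm
  rw [← e.lintegral_comp hF, Measure.volume_eq_prod, lintegral_prod_symm]
  · simp [MeasurableEquiv.piFinSuccAbove, Fin.insertNthEquiv]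
  · exact (hF.comp e.measurable).aemeasurable

theorem lintegral_gaussian_pi {a : ℝ} (ha : 0 < a) (n : ℕ) :
    ∫⁻ z : Fin n → ℂ, ENNReal.ofReal (Real.exp (-a * ∑ i, ‖z i‖ ^ 2)) =
      ENNReal.ofReal ((Real.pi / a) ^ n) := by
  induction n with
  | zero => simp [lintegral_unique, volume_pi]
  | succ n ih =>
    rw [lintegral_fin_succ (by fun_prop)]
    simp_rw [Fin.sum_univ_succ, Fin.cons_zero, Fin.cons_succ, mul_add, Real.exp_add]
    simp_rw [ENNReal.ofReal_mul (Real.exp_pos _).le]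
    simp_rw [lintegral_mul_const _ (f := fun z : ℂ => ENNReal.ofReal (Real.exp (-a * ‖z‖ ^ 2)))
      (by fun_prop), lintegral_gaussian_complex ha]
    rw [lintegral_const_mul _ (by fun_prop), ih, ← ENNReal.ofReal_mul (by positivity), pow_succ']

/-- The Gaussian mass of the cone of vectors whose first coordinate carries more than the
fraction `t` of the squared norm. -/
theorem lintegral_gaussian_cone {t : ℝ} (ht : 0 ≤ t) (ht1 : t < 1) (n : ℕ) :
    ∫⁻ z : Fin (n + 1) → ℂ, {z : Fin (n + 1) → ℂ | t * ∑ i, ‖z i‖ ^ 2 < ‖z 0‖ ^ 2}.indicator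
      (fun z => ENNReal.ofReal (Real.exp (-∑ i, ‖z i‖ ^ 2))) z =
      ENNReal.ofReal ((1 - t) ^ n) *
        ∫⁻ z : Fin (n + 1) → ℂ, ENNReal.ofReal (Real.exp (-∑ i, ‖z i‖ ^ 2)) := by
  have h1t : 0 < 1 - t := by linarith
  have hs : 0 ≤ t / (1 - t) := by positivity
  have key : ∀ (w : Fin n → ℂ) (z : ℂ),
      {z : Fin (n + 1) → ℂ | t * ∑ i, ‖z i‖ ^ 2 < ‖z 0‖ ^ 2}.indicator
        (fun z => ENNReal.ofReal (Real.exp (-∑ i, ‖z i‖ ^ 2))) (Fin.cons z w) =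
      {z : ℂ | t / (1 - t) * ∑ i, ‖w i‖ ^ 2 < ‖z‖ ^ 2}.indicator
        (fun z => ENNReal.ofReal (Real.exp (-1 * ‖z‖ ^ 2))) z *
        ENNReal.ofReal (Real.exp (-∑ i, ‖w i‖ ^ 2)) := by
    intro w z
    -- With `w` frozen, the slice of the cone is the exterior of a disc: collect the `‖z‖ ^ 2` terms
    -- and divide by `1 - t > 0`.
    have hiff : t * ∑ i, ‖(Fin.cons z w : Fin (n + 1) → ℂ) i‖ ^ 2 <
        ‖(Fin.cons z w : Fin (n + 1) → ℂ) 0‖ ^ 2 ↔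
        t / (1 - t) * ∑ i, ‖w i‖ ^ 2 < ‖z‖ ^ 2 := by
      rw [Fin.sum_univ_succ]
      simp only [Fin.cons_zero, Fin.cons_succ]
      rw [div_mul_eq_mul_div, div_lt_iff₀ h1t]
      constructor <;> intro h <;> linarith
    simp only [indicator_apply, mem_ofPred_eq]
    by_cases h : t / (1 - t) * ∑ i, ‖w i‖ ^ 2 < ‖z‖ ^ 2
    · rw [if_pos (hiff.2 h), if_pos h, ← ENNReal.ofReal_mul (Real.exp_pos _).le, ← Real.exp_add,
        Fin.sum_univ_succ]
      simp only [Fin.cons_zero, Fin.cons_succ]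
      ring_nf
    · rw [if_neg (fun h' => h (hiff.1 h')), if_neg h, zero_mul]
  have htot := lintegral_gaussian_pi one_pos (n + 1)
  simp only [neg_one_mul, div_one] at htot
  rw [htot, lintegral_fin_succ]
  · simp_rw [key]
    have hm : ∀ w : Fin n → ℂ, Measurable ({z : ℂ | t / (1 - t) * ∑ i, ‖w i‖ ^ 2 < ‖z‖ ^ 2}.indicator
        (fun z => ENNReal.ofReal (Real.exp (-1 * ‖z‖ ^ 2)))) := fun w =>
      Measurable.indicator (by fun_prop) (measurableSet_lt (by fun_prop) (by fun_prop))
    simp_rw [lintegral_mul_const _ (hm _)]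
    have hw : ∀ w : Fin n → ℂ, 0 ≤ t / (1 - t) * ∑ i, ‖w i‖ ^ 2 := fun w => by positivity
    simp_rw [lintegral_gaussian_exterior_disc one_pos (hw _)]
    -- Since `t/(1-t) + 1 = 1/(1-t)`, the remaining Gaussian has variance scaled by `1 - t` in each
    -- of `n` complex coordinates.
    have hcomb : ∀ w : Fin n → ℂ,
        ENNReal.ofReal (Real.pi / 1 * Real.exp (-1 * (t / (1 - t) * ∑ i, ‖w i‖ ^ 2))) *
          ENNReal.ofReal (Real.exp (-∑ i, ‖w i‖ ^ 2)) =
        ENNReal.ofReal Real.pi * ENNReal.ofReal (Real.exp (-(1 / (1 - t)) * ∑ i, ‖w i‖ ^ 2)) := by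
      intro w
      rw [← ENNReal.ofReal_mul (by positivity), ← ENNReal.ofReal_mul Real.pi_pos.le, div_one,
        mul_assoc, ← Real.exp_add]
      congr 3
      field_simp
      ring
    simp_rw [hcomb]
    rw [lintegral_const_mul _ (by fun_prop), lintegral_gaussian_pi (by positivity),
      ← ENNReal.ofReal_mul Real.pi_pos.le, ← ENNReal.ofReal_mul (by positivity)]
    congr 1
    rw [div_div_eq_mul_div, div_one, mul_pow]
    ring
  · exact Measurable.indicator (by fun_prop) (measurableSet_lt (by fun_prop) (by fun_prop))

/-! ### Topology of projective space and the unitary action -/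

namespace PureState

variable {H : Type*} [NormedAddCommGroup H] [InnerProductSpace ℂ H]

/-- The saturation of an open set is the union of its nonzero scalar multiples. Openness matters
because open quotient maps, unlike general quotient maps, are stable under products and pass on
second countability. -/
theorem isOpenQuotientMap_mk' : IsOpenQuotientMap (Projectivization.mk' ℂ (V := H)) := by
  refine ⟨Quotient.mk''_surjective, continuous_mk', fun s hs => ?_⟩
  rw [isOpen_coinduced]
  have hset : Projectivization.mk' ℂ (V := H) ⁻¹' (Projectivization.mk' ℂ '' s) =
      ⋃ a : ℂˣ, {v : {v : H // v ≠ 0} | (⟨a • (v : H), (smul_ne_zero_iff_ne a).2 v.2⟩ :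
        {v : H // v ≠ 0}) ∈ s} := by
    ext v
    simp only [mem_preimage, mem_image, mem_iUnion, mem_ofPred_eq]
    constructor
    · rintro ⟨w, hw, hwv⟩
      obtain ⟨a, ha⟩ := (Projectivization.mk_eq_mk_iff ℂ _ _ w.2 v.2).1 hwv
      refine ⟨a, ?_⟩
      convert hw
    · rintro ⟨a, ha⟩
      exact ⟨_, ha, (Projectivization.mk_eq_mk_iff ℂ _ _ _ v.2).2 ⟨a, rfl⟩⟩
  rw [hset]
  refine isOpen_iUnion fun a => hs.preimage ?_
  exact Continuous.subtype_mk (continuous_subtype_val.const_smul a) _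

/-- Makes the Borel sigma-algebra of `ℙ × ℙ` the product one, so that the continuous overlap is
jointly measurable. -/
instance [FiniteDimensional ℂ H] : SecondCountableTopology (ℙ ℂ H) := by
  have : ProperSpace H := FiniteDimensional.proper ℂ H
  exact isOpenQuotientMap_mk'.isQuotientMap.secondCountableTopology isOpenQuotientMap_mk'.isOpenMap

theorem continuous_overlap : Continuous fun x : ℙ ℂ H × ℙ ℂ H => overlap x.1 x.2 := by
  rw [← (isOpenQuotientMap_mk'.prodMap isOpenQuotientMap_mk').continuous_comp_iff]
  have h : (fun x : ℙ ℂ H × ℙ ℂ H => overlap x.1 x.2) ∘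
      Prod.map (Projectivization.mk' ℂ) (Projectivization.mk' ℂ) =
      fun x : {v : H // v ≠ 0} × {v : H // v ≠ 0} =>
        ‖inner ℂ (x.1 : H) (x.2 : H)‖ / (‖(x.1 : H)‖ * ‖(x.2 : H)‖) := by
    ext x
    exact overlap_mk _ _ x.1.2 x.2.2
  rw [h]
  refine Continuous.div (by fun_prop) (by fun_prop) fun x => ?_
  exact mul_ne_zero (norm_ne_zero_iff.2 x.1.2) (norm_ne_zero_iff.2 x.2.2)

theorem overlap_nonneg (p q : ℙ ℂ H) : 0 ≤ overlap p q := by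
  unfold overlap
  positivity

theorem overlap_le_one (p q : ℙ ℂ H) : overlap p q ≤ 1 :=
  div_le_one_of_le₀ (norm_inner_le_norm _ _) (by positivity)

theorem overlap_rayMap (U : H ≃ₗᵢ[ℂ] H) (p q : ℙ ℂ H) :
    overlap (rayMap U p) (rayMap U q) = overlap p q := by
  induction p using Projectivization.ind with | _ v hv
  induction q using Projectivization.ind with | _ w hw
  have hU : ∀ x : H, x ≠ 0 → U x ≠ 0 := fun x hx h => hx (U.injective (by simpa using h))
  have : ∀ (x : H) (hx : x ≠ 0), rayMap U (Projectivization.mk ℂ x hx) =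
      Projectivization.mk ℂ (U x) (hU x hx) := fun x hx => rfl
  rw [this, this, overlap_mk, overlap_mk]
  simp

/-- Every ray is spanned by the first vector of an orthonormal basis. -/
theorem exists_orthonormalBasis_mk_zero [FiniteDimensional ℂ H] {n : ℕ}
    (hn : Module.finrank ℂ H = n + 1) (q : ℙ ℂ H) :
    ∃ b : OrthonormalBasis (Fin (n + 1)) ℂ H,
      q = Projectivization.mk ℂ (b 0) (b.orthonormal.ne_zero 0) := by
  induction q using Projectivization.ind with | _ w hw
  let e : H := ((‖w‖⁻¹ : ℝ) : ℂ) • w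
  have hw0 : ‖w‖ ≠ 0 := norm_ne_zero_iff.2 hw
  have hnorm : ‖e‖ = 1 := by
    simp [e, norm_smul, hw0]
  have ho : Orthonormal ℂ (({0} : Set (Fin (n + 1))).domRestrict fun _ => e) := by
    constructor
    · intro i
      exact hnorm
    · intro i j hij
      exact absurd (Subtype.ext (i.2.trans j.2.symm)) hij
  obtain ⟨b, hb⟩ := ho.exists_orthonormalBasis_extension_of_card_eq (by simp [hn])
  refine ⟨b, ?_⟩
  rw [Projectivization.mk_eq_mk_iff']
  refine ⟨(‖w‖ : ℂ), ?_⟩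
  rw [hb 0 rfl, smul_smul]
  simp [hw0]

/-- Carry an orthonormal basis starting on `p` to one starting on `q`. -/
theorem exists_rayMap_eq [FiniteDimensional ℂ H] {n : ℕ} (hn : Module.finrank ℂ H = n + 1)
    (p q : ℙ ℂ H) : ∃ U : H ≃ₗᵢ[ℂ] H, rayMap U p = q := by
  obtain ⟨b, rfl⟩ := exists_orthonormalBasis_mk_zero hn p
  obtain ⟨b', rfl⟩ := exists_orthonormalBasis_mk_zero hn q
  refine ⟨b.equiv b' (Equiv.refl _), ?_⟩
  rw [rayMap, Projectivization.map_mk, Projectivization.mk_eq_mk_iff']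
  refine ⟨1, ?_⟩
  simp

/-! ### The overlap law, via the Gaussian measure on rays -/

/-- Additive Haar measure is the Lebesgue measure of the coordinates in an orthonormal basis, up
to a constant. -/
theorem exists_lintegral_addHaar_eq [FiniteDimensional ℂ H] [MeasurableSpace H] [BorelSpace H]
    {n : ℕ} (m : Measure H) [m.IsAddHaarMeasure] (b : OrthonormalBasis (Fin n) ℂ H) :
    ∃ c : ℝ≥0∞, c ≠ 0 ∧ c ≠ ∞ ∧ ∀ F : (Fin n → ℂ) → ℝ≥0∞, Measurable F →
      ∫⁻ v, F (fun i => inner ℂ (b i) v) ∂m = c * ∫⁻ z, F z := by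
  let L : H ≃L[ℂ] (Fin n → ℂ) := b.toBasis.equivFunL
  have hL : ∀ v, L v = fun i => inner ℂ (b i) v := by
    intro v
    ext i
    simp [L, b.repr_apply_apply]
  have h1 : (m.map L).IsAddHaarMeasure := L.isAddHaarMeasure_map m
  have h2 := Measure.isAddLeftInvariant_eq_smul (m.map L) (volume : Measure (Fin n → ℂ))
  set c := Measure.addHaarScalarFactor (m.map L) (volume : Measure (Fin n → ℂ))
  refine ⟨c, ?_, ENNReal.coe_ne_top, fun F hF => ?_⟩
  · intro h
    have hc : c = 0 := by exact_mod_cast h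
    rw [hc, zero_smul] at h2
    exact NeZero.ne (m.map L) h2
  · have : ∫⁻ z, F z ∂(m.map L) = ∫⁻ v, F (L v) ∂m :=
      lintegral_map hF L.continuous.measurable
    simp_rw [← hL]
    rw [← this, h2, lintegral_smul_measure]
    rfl

/-- A reference measure with an explicit tail around every ray: the Gaussian on `H` pushed to rays.
The density depends only on the norm, so for each `q` the computation may use a basis adapted to
`q`. -/
theorem exists_finite_measure_overlap_tail [FiniteDimensional ℂ H] {n : ℕ}
    (hn : Module.finrank ℂ H = n + 1) :
    ∃ γ : Measure (ℙ ℂ H), IsFiniteMeasure γ ∧ γ univ ≠ 0 ∧ ∀ (q : ℙ ℂ H) (t : ℝ), 0 ≤ t → t < 1 →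
      γ {p | t < overlap p q ^ 2} = ENNReal.ofReal ((1 - t) ^ n) * γ univ := by
  let _ : MeasurableSpace H := borel H
  have : BorelSpace H := ⟨rfl⟩
  let _ : InnerProductSpace ℝ H := InnerProductSpace.complexToReal
  have : FiniteDimensional ℝ H := FiniteDimensional.complexToReal H
  have : Nontrivial H := Module.nontrivial_of_finrank_pos (R := ℂ) (by omega)
  let m : Measure H := Measure.addHaar
  let ν : Measure H := m.withDensity fun v => ENNReal.ofReal (Real.exp (-‖v‖ ^ 2))
  have hν0 : ν {0} = 0 :=
    withDensity_absolutelyContinuous m _ (measure_singleton 0)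
  have hemb : MeasurableEmbedding (Subtype.val : {v : H // v ≠ 0} → H) :=
    MeasurableEmbedding.subtype_coe (measurableSet_singleton (0 : H)).compl
  have hmk : Measurable (Projectivization.mk' ℂ (V := H)) := continuous_mk'.measurable
  let γ : Measure (ℙ ℂ H) := (ν.comap Subtype.val).map (Projectivization.mk' ℂ)
  have hγ : ∀ B, MeasurableSet B →
      γ B = ν (Subtype.val '' (Projectivization.mk' ℂ (V := H) ⁻¹' B)) := fun B hB => by
    rw [Measure.map_apply hmk hB, hemb.comap_apply]
  have hγuniv : γ univ = ν univ := by
    rw [hγ _ .univ, preimage_univ, image_univ, Subtype.range_coe_subtype]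
    exact measure_eq_measure_of_null_sdiff (subset_univ _)
      (measure_mono_null (fun x hx => by simpa using hx) hν0)
  have hnormsq : ∀ (b : OrthonormalBasis (Fin (n + 1)) ℂ H) (v : H),
      ‖v‖ ^ 2 = ∑ i, ‖inner ℂ (b i) v‖ ^ 2 := fun b v => (b.sum_sq_norm_inner_right v).symm
  have hνuniv : ∀ b : OrthonormalBasis (Fin (n + 1)) ℂ H, ν univ =
      ∫⁻ v, (fun z : Fin (n + 1) → ℂ => ENNReal.ofReal (Real.exp (-∑ i, ‖z i‖ ^ 2)))
        (fun i => inner ℂ (b i) v) ∂m := by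
    intro b
    simp only [ν, withDensity_apply _ MeasurableSet.univ, Measure.restrict_univ]
    simp_rw [hnormsq b]
  have hG : Measurable fun z : Fin (n + 1) → ℂ =>
      ENNReal.ofReal (Real.exp (-∑ i, ‖z i‖ ^ 2)) := by fun_prop
  have hI : ∫⁻ z : Fin (n + 1) → ℂ, ENNReal.ofReal (Real.exp (-∑ i, ‖z i‖ ^ 2)) =
      ENNReal.ofReal (Real.pi ^ (n + 1)) := by
    simpa using lintegral_gaussian_pi one_pos (n + 1)
  obtain ⟨v₀, hv₀⟩ := exists_ne (0 : H)
  obtain ⟨b₀, -⟩ := exists_orthonormalBasis_mk_zero hn (Projectivization.mk ℂ v₀ hv₀)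
  obtain ⟨c₀, hc₀, hc₀', hF₀⟩ := exists_lintegral_addHaar_eq m b₀
  have htot : γ univ = c₀ * ENNReal.ofReal (Real.pi ^ (n + 1)) := by
    rw [hγuniv, hνuniv b₀, ← hI]
    exact hF₀ _ hG
  refine ⟨γ, ⟨?_⟩, ?_, fun q t ht ht1 => ?_⟩
  · rw [htot]
    exact ENNReal.mul_lt_top hc₀'.lt_top ENNReal.ofReal_lt_top
  · rw [htot]
    exact mul_ne_zero hc₀ (ENNReal.ofReal_pos.2 (by positivity)).ne'
  · obtain ⟨b, rfl⟩ := exists_orthonormalBasis_mk_zero hn q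
    obtain ⟨c, hc, hc', hF⟩ := exists_lintegral_addHaar_eq m b
    have hmeas : MeasurableSet {p : ℙ ℂ H |
        t < overlap p (Projectivization.mk ℂ (b 0) (b.orthonormal.ne_zero 0)) ^ 2} := by
      refine measurableSet_lt measurable_const (Measurable.pow_const ?_ 2)
      exact (continuous_overlap.comp (Continuous.prodMk_left _)).measurable
    have hset : Subtype.val '' (Projectivization.mk' ℂ (V := H) ⁻¹' {p : ℙ ℂ H |
        t < overlap p (Projectivization.mk ℂ (b 0) (b.orthonormal.ne_zero 0)) ^ 2}) =
        {v : H | t * ‖v‖ ^ 2 < ‖inner ℂ (b 0) v‖ ^ 2} := by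
      ext v
      have hov : ∀ hv : v ≠ 0, t < overlap (Projectivization.mk ℂ v hv)
          (Projectivization.mk ℂ (b 0) (b.orthonormal.ne_zero 0)) ^ 2 ↔
          t * ‖v‖ ^ 2 < ‖inner ℂ (b 0) v‖ ^ 2 := by
        intro hv
        have : 0 < ‖v‖ := norm_pos_iff.2 hv
        rw [overlap_mk, b.orthonormal.1 0, mul_one, div_pow, lt_div_iff₀ (by positivity),
          norm_inner_symm]
      constructor
      · rintro ⟨⟨w, hw⟩, h, rfl⟩
        exact (hov hw).1 h
      · intro h
        have hv : v ≠ 0 := by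
          rintro rfl
          simp at h
        exact ⟨⟨v, hv⟩, (hov hv).2 h, rfl⟩
    have hms : MeasurableSet {v : H | t * ‖v‖ ^ 2 < ‖inner ℂ (b 0) v‖ ^ 2} :=
      measurableSet_lt (by fun_prop) (by fun_prop)
    have hcone := lintegral_gaussian_cone ht ht1 n
    have hνb : ν univ = c * ∫⁻ z : Fin (n + 1) → ℂ,
        ENNReal.ofReal (Real.exp (-∑ i, ‖z i‖ ^ 2)) := (hνuniv b).trans (hF _ hG)
    rw [hγ _ hmeas, hset, hγuniv, hνb, mul_left_comm, ← hcone]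
    refine Eq.trans ?_ (hF _
      (Measurable.indicator hG (measurableSet_lt (by fun_prop) (by fun_prop))))
    simp only [ν]
    rw [withDensity_apply _ hms, ← lintegral_indicator hms]
    refine lintegral_congr fun v => ?_
    simp only [indicator_apply, mem_ofPred_eq, ← hnormsq b v]

/-- The law of the overlap of a Haar-random state with a fixed state. -/
theorem IsHaarState.measure_overlap_tail [FiniteDimensional ℂ H] {n : ℕ}
    (hn : Module.finrank ℂ H = n + 1) {μ : Measure (ℙ ℂ H)} (hμ : IsHaarState μ) (p : ℙ ℂ H)
    {t : ℝ} (ht : 0 ≤ t) (ht1 : t < 1) :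
    μ {q | t < overlap p q ^ 2} = ENNReal.ofReal ((1 - t) ^ n) := by
  have := hμ.1
  obtain ⟨γ, hγ, hγ0, hγt⟩ := exists_finite_measure_overlap_tail hn
  have hmeas : MeasurableSet {x : ℙ ℂ H × ℙ ℂ H | t < overlap x.1 x.2 ^ 2} :=
    measurableSet_lt measurable_const (continuous_overlap.measurable.pow_const 2)
  -- Unitary invariance enters here: move `p` to `p'` by a unitary, which preserves both `μ` and the
  -- overlap.
  have hconst : ∀ p', μ {q | t < overlap p' q ^ 2} = μ {q | t < overlap p q ^ 2} := by
    intro p'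
    obtain ⟨U, rfl⟩ := exists_rayMap_eq hn p p'
    conv_lhs => rw [← hμ.2 U]
    have hs : MeasurableSet {q | t < overlap (rayMap U p) q ^ 2} := measurable_prodMk_left hmeas
    rw [Measure.map_apply (continuous_rayMap U).measurable hs]
    simp [preimage, overlap_rayMap]
  -- `h1` and `h2` compute the same mass in the two orders of integration; cancelling `γ univ` needs
  -- it nonzero and finite.
  have h1 : (γ.prod μ) {x | t < overlap x.1 x.2 ^ 2} = μ {q | t < overlap p q ^ 2} * γ univ := by
    rw [Measure.prod_apply hmeas]
    simp only [preimage, mem_ofPred_eq, hconst, lintegral_const]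
  have h2 : (γ.prod μ) {x | t < overlap x.1 x.2 ^ 2} = ENNReal.ofReal ((1 - t) ^ n) * γ univ := by
    rw [Measure.prod_apply_symm hmeas]
    simp only [preimage, mem_ofPred_eq, hγt _ t ht ht1, lintegral_const, measure_univ, mul_one]
  exact (ENNReal.mul_left_inj hγ0 (measure_ne_top γ _)).1 (h1.symm.trans h2)

end PureState

/-! ### The Beta distribution -/

/-- The tail of the distribution `Beta(1, n + 1)`. -/
theorem betaMeasure_one_Ioi (n : ℕ) {t : ℝ} (ht : 0 ≤ t) (ht1 : t < 1) :
    betaMeasure 1 ((n : ℝ) + 1) (Ioi t) = ENNReal.ofReal ((1 - t) ^ (n + 1)) := by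
  have hbeta : 1 / beta 1 ((n : ℝ) + 1) = n + 1 := by
    rw [beta, Real.Gamma_one, one_mul, add_comm 1 ((n : ℝ) + 1),
      Real.Gamma_add_one (s := (n : ℝ) + 1) (by positivity)]
    have : Real.Gamma ((n : ℝ) + 1) ≠ 0 := (Real.Gamma_pos_of_pos (by positivity)).ne'
    field_simp
  have hpdf : ∀ x ∈ Ioi t, betaPDF 1 ((n : ℝ) + 1) x =
      (Iio (1 : ℝ)).indicator (fun x => ENNReal.ofReal ((n + 1) * (1 - x) ^ n)) x := by
    intro x hx
    have hx0 : 0 < x := ht.trans_lt hx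
    by_cases hx1 : x < 1
    · rw [betaPDF_of_pos_lt_one hx0 hx1, indicator_of_mem (show x ∈ Iio 1 from hx1), hbeta]
      simp
    · rw [betaPDF_eq_zero_of_one_le (not_lt.1 hx1), indicator_of_notMem (by simpa using hx1)]
  rw [betaMeasure, withDensity_apply _ measurableSet_Ioi,
    setLIntegral_congr_fun measurableSet_Ioi hpdf, lintegral_indicator measurableSet_Iio,
    Measure.restrict_restrict measurableSet_Iio, inter_comm, Ioi_inter_Iio,
    restrict_Ioo_eq_restrict_Ioc]
  have hint : IntervalIntegrable (fun x : ℝ => ((n : ℝ) + 1) * (1 - x) ^ n) volume t 1 :=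
    Continuous.intervalIntegrable (by fun_prop) _ _
  rw [← ofReal_integral_eq_lintegral_ofReal
    ((intervalIntegrable_iff_integrableOn_Ioc_of_le ht1.le).1 hint),
    ← intervalIntegral.integral_of_le ht1.le,
    intervalIntegral.integral_eq_sub_of_hasDerivAt (f := fun x => -(1 - x) ^ (n + 1)) _ hint]
  · simp
  · intro x _
    have := (((hasDerivAt_id x).const_sub 1).pow (n + 1)).neg
    refine this.congr_deriv ?_
    simp
  · refine (ae_restrict_iff' measurableSet_Ioc).2 (ae_of_all _ fun x hx => ?_)
    have : 0 ≤ 1 - x := by linarith [hx.2]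
    positivity

/-- The mean of the square root of a `Beta(1, n + 1)` variable. -/
theorem integral_sqrt_betaMeasure_one (n : ℕ) :
    ∫ x, Real.sqrt x ∂(betaMeasure 1 ((n : ℝ) + 1)) =
      Real.Gamma (3 / 2) * Real.Gamma ((n : ℝ) + 2) / Real.Gamma ((n : ℝ) + 5 / 2) := by
  have hb1 : 0 < beta 1 ((n : ℝ) + 1) := beta_pos one_pos (by positivity)
  have hb2 : 0 < beta (3 / 2) ((n : ℝ) + 1) := beta_pos (by norm_num) (by positivity)
  -- The factor `√x` shifts the first Beta parameter from `1` to `3/2`, leaving only a ratio of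
  -- normalizing constants.
  have hdens : ∀ x, betaPDFReal 1 ((n : ℝ) + 1) x * Real.sqrt x =
      beta (3 / 2) ((n : ℝ) + 1) / beta 1 ((n : ℝ) + 1) * betaPDFReal (3 / 2) ((n : ℝ) + 1) x := by
    intro x
    unfold betaPDFReal
    split_ifs with h
    · rw [sub_self, Real.rpow_zero, Real.sqrt_eq_rpow]
      norm_num
      field_simp
    · simp
  have hnn : ∀ a, 0 < a → ∀ x, 0 ≤ betaPDFReal a ((n : ℝ) + 1) x := by
    intro a ha x
    by_cases h : 0 < x ∧ x < 1
    · exact (betaPDFReal_pos h.1 h.2 ha (by positivity)).le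
    · simp [betaPDFReal, h]
  have hone : ∫ x, betaPDFReal (3 / 2) ((n : ℝ) + 1) x = 1 := by
    rw [integral_eq_lintegral_of_nonneg_ae (ae_of_all _ (hnn _ (by norm_num))) (by fun_prop)]
    have := lintegral_betaPDF_eq_one (α := 3 / 2) (β := (n : ℝ) + 1) (by norm_num) (by positivity)
    unfold betaPDF at this
    rw [this, ENNReal.toReal_one]
  have hmeas : Measurable (betaPDF 1 ((n : ℝ) + 1)) :=
    (measurable_betaPDFReal 1 ((n : ℝ) + 1)).ennreal_ofReal
  rw [betaMeasure, integral_withDensity_eq_integral_toReal_smul hmeas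
    (ae_of_all _ fun x => ENNReal.ofReal_lt_top)]
  simp_rw [betaPDF, ENNReal.toReal_ofReal (hnn 1 one_pos _), smul_eq_mul, hdens]
  rw [integral_const_mul, hone, mul_one, beta, beta, Real.Gamma_one]
  have h1 : Real.Gamma ((n : ℝ) + 1) ≠ 0 := (Real.Gamma_pos_of_pos (by positivity)).ne'
  rw [show (3 / 2 : ℝ) + (n + 1) = n + 5 / 2 by ring, show (1 : ℝ) + (n + 1) = n + 2 by ring]
  field_simp

/-! ### Bounds for the Gamma ratio -/

/-- Log-convexity of Γ at the midpoint of `x` and `x + 1`. Used at `x` it bounds the Gamma ratio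
below, at `x - 1/2` above. -/
theorem Real.Gamma_mid_sq_le {x : ℝ} (hx : 0 < x) :
    Real.Gamma (x + 1 / 2) ^ 2 ≤ Real.Gamma x * Real.Gamma (x + 1) := by
  have hx1 := Real.Gamma_pos_of_pos hx
  have hx2 := Real.Gamma_pos_of_pos (show 0 < x + 1 by linarith)
  have h := Real.Gamma_mul_add_mul_le_rpow_Gamma_mul_rpow_Gamma hx (show 0 < x + 1 by linarith)
    (a := 1 / 2) (b := 1 / 2) (by norm_num) (by norm_num) (by norm_num)
  rw [show 1 / 2 * x + 1 / 2 * (x + 1) = x + 1 / 2 by ring, ← Real.sqrt_eq_rpow,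
    ← Real.sqrt_eq_rpow, ← Real.sqrt_mul hx1.le] at h
  calc _ ≤ Real.sqrt (Real.Gamma x * Real.Gamma (x + 1)) ^ 2 := by
        have := Real.Gamma_pos_of_pos (show 0 < x + 1 / 2 by linarith)
        gcongr
    _ = _ := Real.sq_sqrt (by positivity)

theorem Real.inv_sqrt_le_Gamma_ratio {x : ℝ} (hx : 0 < x) :
    1 / Real.sqrt x ≤ Real.Gamma x / Real.Gamma (x + 1 / 2) := by
  have hg := Real.Gamma_pos_of_pos hx
  have hg' := Real.Gamma_pos_of_pos (show 0 < x + 1 / 2 by linarith)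
  have h := Real.Gamma_mid_sq_le hx
  rw [Real.Gamma_add_one hx.ne'] at h
  rw [div_le_div_iff₀ (Real.sqrt_pos.2 hx) hg', one_mul]
  refine le_of_sq_le_sq ?_ (by positivity)
  rw [mul_pow, Real.sq_sqrt hx.le]
  linarith

theorem Real.Gamma_ratio_le_inv_sqrt {x : ℝ} (hx : 1 / 2 < x) :
    Real.Gamma x / Real.Gamma (x + 1 / 2) ≤ 1 / Real.sqrt (x - 1 / 2) := by
  have hx' : 0 < x - 1 / 2 := by linarith
  have hg := Real.Gamma_pos_of_pos (show 0 < x by linarith)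
  have hg' := Real.Gamma_pos_of_pos (show 0 < x + 1 / 2 by linarith)
  have h := Real.Gamma_mid_sq_le hx'
  rw [sub_add_cancel, show x - 1 / 2 + 1 = x + 1 / 2 by ring] at h
  have h2 : Real.Gamma (x + 1 / 2) = (x - 1 / 2) * Real.Gamma (x - 1 / 2) := by
    rw [← Real.Gamma_add_one hx'.ne']
    ring_nf
  rw [div_le_div_iff₀ hg' (Real.sqrt_pos.2 hx'), one_mul]
  refine le_of_sq_le_sq ?_ hg'.le
  rw [mul_pow, Real.sq_sqrt hx'.le]
  nlinarith

theorem Real.rpow_neg_three_halves {x : ℝ} (hx : 0 < x) :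
    x ^ (-(3 / 2) : ℝ) = 1 / (x * Real.sqrt x) := by
  rw [Real.rpow_neg hx.le, show (3 / 2 : ℝ) = 1 + 1 / 2 by norm_num, Real.rpow_add hx,
    Real.rpow_one, Real.sqrt_eq_rpow]
  simp only [one_div]

theorem Real.inv_sqrt_sub_half_le {x : ℝ} (hx : 1 ≤ x) :
    1 / Real.sqrt (x - 1 / 2) ≤ 1 / Real.sqrt x + x ^ (-(3 / 2) : ℝ) := by
  have hx0 : 0 < x := by linarith
  have hs := Real.sqrt_pos.2 hx0
  have hy : 0 < x - 1 / 2 := by linarith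
  have heq : 1 / Real.sqrt x + 1 / (x * Real.sqrt x) = (x + 1) / (x * Real.sqrt x) := by
    field_simp
  rw [Real.rpow_neg_three_halves hx0, heq, div_le_div_iff₀ (Real.sqrt_pos.2 hy) (by positivity), one_mul]
  refine le_of_sq_le_sq ?_ (by positivity)
  rw [mul_pow, mul_pow, Real.sq_sqrt hx0.le, Real.sq_sqrt hy.le]
  -- The squared claim is `x³ ≤ (x+1)²(x-1/2) = x³ + 3x²/2 - 1/2`.
  nlinarith [sq_nonneg x]

theorem Real.Gamma_three_halves : Real.Gamma (3 / 2) = Real.sqrt Real.pi / 2 := by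
  rw [show (3 / 2 : ℝ) = 1 / 2 + 1 by norm_num, Real.Gamma_add_one (by norm_num),
    Real.Gamma_one_half_eq]
  ring

/-! ### Law, mean and concentration for the random pair -/

namespace PureState

theorem overlap_eq_one_of_finrank_eq_one {H : Type*} [NormedAddCommGroup H]
    [InnerProductSpace ℂ H] (h : Module.finrank ℂ H = 1) (p q : ℙ ℂ H) : overlap p q = 1 := by
  induction p using Projectivization.ind with | _ v hv
  induction q using Projectivization.ind with | _ w hw
  obtain ⟨c, rfl⟩ := exists_smul_eq_of_finrank_eq_one h hv w
  have hc : ‖c‖ ≠ 0 := norm_ne_zero_iff.2 fun hc => hw (by simp [hc])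
  have hv0 : ‖v‖ ≠ 0 := norm_ne_zero_iff.2 hv
  rw [overlap_mk, inner_smul_right, inner_self_eq_norm_sq_to_K, norm_smul]
  simp
  field_simp

namespace IndepHaarPair

variable {d : ℕ}

theorem finiteDimensional (hd : 1 ≤ d) (S : IndepHaarPair.{u, v} d) : FiniteDimensional ℂ S.H :=
  Module.finite_of_finrank_pos (by rw [S.finrank_eq]; omega)

theorem r_nonneg (S : IndepHaarPair.{u, v} d) (ω : S.Ω) : 0 ≤ S.r ω := overlap_nonneg _ _

theorem r_le_one (S : IndepHaarPair.{u, v} d) (ω : S.Ω) : S.r ω ≤ 1 := overlap_le_one _ _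

theorem aemeasurable_r (hd : 1 ≤ d) (S : IndepHaarPair.{u, v} d) : AEMeasurable S.r S.P := by
  have := S.finiteDimensional hd
  have h : Measurable fun x : ℙ ℂ S.H × ℙ ℂ S.H => overlap x.1 x.2 :=
    continuous_overlap.measurable
  have h' := h.comp_aemeasurable (S.aemeasurable_fst.prodMk S.aemeasurable_snd)
  refine h'.congr (ae_of_all _ fun ω => ?_)
  rw [r, Function.comp_apply]

theorem integrable_r (hd : 1 ≤ d) (S : IndepHaarPair.{u, v} d) : Integrable S.r S.P :=
  Integrable.of_bound (S.aemeasurable_r hd).aestronglyMeasurable 1 (ae_of_all _ fun ω => by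
    rw [Real.norm_of_nonneg (S.r_nonneg ω)]
    exact S.r_le_one ω)

/-- By independence the joint law is a product; given the first state, the tail in the second is a
constant. -/
theorem measure_r_sq_tail {n : ℕ} (S : IndepHaarPair.{u, v} (n + 1)) {t : ℝ} (ht : 0 ≤ t)
    (ht1 : t < 1) : S.P {ω | t < S.r ω ^ 2} = ENNReal.ofReal ((1 - t) ^ n) := by
  have := S.finiteDimensional (by omega)
  have h1 := S.haar_fst.1
  have h2 := S.haar_snd.1
  have hmeas : MeasurableSet {x : ℙ ℂ S.H × ℙ ℂ S.H | t < overlap x.1 x.2 ^ 2} :=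
    measurableSet_lt measurable_const (continuous_overlap.measurable.pow_const 2)
  have hmap := (indepFun_iff_map_prod_eq_prod_map_map S.aemeasurable_fst S.aemeasurable_snd).1
    S.indep
  have h := Measure.map_apply_of_aemeasurable (S.aemeasurable_fst.prodMk S.aemeasurable_snd) hmeas
  rw [hmap, Measure.prod_apply hmeas] at h
  refine h.symm.trans ?_
  simp only [preimage, mem_ofPred_eq, S.haar_snd.measure_overlap_tail S.finrank_eq _ ht ht1,
    lintegral_const, measure_univ, mul_one]

/-- Probability measures on `ℝ` are determined by half-lines. The tail formula covers `0 ≤ a < 1`;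
its value `1` at `a = 0` settles `a < 0`, and both tails vanish for `a ≥ 1`. -/
theorem hasLaw_r_sq {n : ℕ} (S : IndepHaarPair.{u, v} (n + 2)) :
    HasLaw (fun ω => S.r ω ^ 2) (betaMeasure 1 ((n : ℝ) + 1)) S.P := by
  have hr : AEMeasurable (fun ω => S.r ω ^ 2) S.P := (S.aemeasurable_r (by omega)).pow_const 2
  refine ⟨hr, ?_⟩
  have hβ : IsProbabilityMeasure (betaMeasure 1 ((n : ℝ) + 1)) :=
    isProbabilityMeasureBeta one_pos (by positivity)
  have hP : IsProbabilityMeasure (S.P.map fun ω => S.r ω ^ 2) := Measure.isProbabilityMeasure_map hr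
  have hmap : ∀ a, (S.P.map fun ω => S.r ω ^ 2) (Ioi a) = S.P {ω | a < S.r ω ^ 2} := fun a =>
    Measure.map_apply_of_aemeasurable hr measurableSet_Ioi
  have hmid : ∀ a, 0 ≤ a → a < 1 → (S.P.map fun ω => S.r ω ^ 2) (Ioi a) =
      betaMeasure 1 ((n : ℝ) + 1) (Ioi a) := fun a ha ha1 => by
    rw [hmap, betaMeasure_one_Ioi n ha ha1, S.measure_r_sq_tail ha ha1]
  have hIoi : ∀ a, (S.P.map fun ω => S.r ω ^ 2) (Ioi a) =
      betaMeasure 1 ((n : ℝ) + 1) (Ioi a) := by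
    intro a
    rcases lt_or_ge a 0 with ha | ha
    · have h0 : betaMeasure 1 ((n : ℝ) + 1) (Ioi 0) = 1 := by
        simp [betaMeasure_one_Ioi n le_rfl one_pos]
      have hsub : Ioi (0 : ℝ) ⊆ Ioi a := Ioi_subset_Ioi ha.le
      rw [le_antisymm prob_le_one ((hmid 0 le_rfl one_pos).trans h0 ▸ measure_mono hsub),
        le_antisymm prob_le_one (h0 ▸ measure_mono hsub)]
    rcases lt_or_ge a 1 with ha1 | ha1
    · exact hmid a ha ha1
    · rw [hmap, betaMeasure, withDensity_apply _ measurableSet_Ioi,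
        setLIntegral_eq_zero measurableSet_Ioi fun x hx =>
          betaPDF_eq_zero_of_one_le (ha1.trans (le_of_lt hx))]
      convert measure_empty (μ := S.P)
      refine eq_empty_of_forall_notMem fun ω (hω : a < S.r ω ^ 2) => ?_
      have := pow_le_one₀ (n := 2) (S.r_nonneg ω) (S.r_le_one ω)
      linarith
  refine Measure.ext_of_Iic _ _ fun a => ?_
  rw [← compl_Ioi, prob_compl_eq_one_sub measurableSet_Ioi, prob_compl_eq_one_sub measurableSet_Ioi,
    hIoi]

theorem integral_r (hd : 1 ≤ d) (S : IndepHaarPair.{u, v} d) :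
    ∫ ω, S.r ω ∂S.P = Real.Gamma (3 / 2) * Real.Gamma d / Real.Gamma (d + 1 / 2) := by
  obtain rfl | ⟨n, rfl⟩ : d = 1 ∨ ∃ n, d = n + 2 := by
    rcases hd.eq_or_lt with h | h
    · exact Or.inl h.symm
    · exact Or.inr ⟨d - 2, by omega⟩
  -- Dimension one is separate, since `Beta(1, 0)` is degenerate: there is only one ray.
  · have : ∀ ω, S.r ω = 1 := fun ω => overlap_eq_one_of_finrank_eq_one S.finrank_eq _ _
    have hg : Real.Gamma (3 / 2) ≠ 0 := (Real.Gamma_pos_of_pos (by norm_num)).ne'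
    simp only [this, integral_const, probReal_univ, smul_eq_mul, mul_one, Nat.cast_one,
      Real.Gamma_one]
    norm_num [hg]
  · have h := S.hasLaw_r_sq.integral_comp (f := Real.sqrt)
      Real.continuous_sqrt.aestronglyMeasurable
    have hsq : ∀ ω, (Real.sqrt ∘ fun ω => S.r ω ^ 2) ω = S.r ω := fun ω =>
      Real.sqrt_sq (S.r_nonneg ω)
    simp only [hsq] at h
    rw [h, integral_sqrt_betaMeasure_one]
    push_cast
    ring_nf

theorem inv_sqrt_le_integral_r (hd : 1 ≤ d) (S : IndepHaarPair.{u, v} d) :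
    Real.sqrt Real.pi / (2 * Real.sqrt d) ≤ ∫ ω, S.r ω ∂S.P := by
  have hd' : (1 : ℝ) ≤ d := by exact_mod_cast hd
  have h := Real.inv_sqrt_le_Gamma_ratio (show (0 : ℝ) < d by linarith)
  rw [S.integral_r hd, Real.Gamma_three_halves, mul_div_assoc]
  calc _ = Real.sqrt Real.pi / 2 * (1 / Real.sqrt d) := by rw [div_mul_div_comm, mul_one]
    _ ≤ _ := by gcongr

theorem integral_r_le (hd : 1 ≤ d) (S : IndepHaarPair.{u, v} d) :
    ∫ ω, S.r ω ∂S.P ≤ Real.sqrt Real.pi / (2 * Real.sqrt d) +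
      Real.sqrt Real.pi / 2 * (d : ℝ) ^ (-(3 / 2) : ℝ) := by
  have hd' : (1 : ℝ) ≤ d := by exact_mod_cast hd
  have h := (Real.Gamma_ratio_le_inv_sqrt (show (1 / 2 : ℝ) < d by linarith)).trans
    (Real.inv_sqrt_sub_half_le hd')
  rw [S.integral_r hd, Real.Gamma_three_halves, mul_div_assoc]
  calc _ ≤ Real.sqrt Real.pi / 2 * (1 / Real.sqrt d + (d : ℝ) ^ (-(3 / 2) : ℝ)) := by gcongr
    _ = _ := by rw [mul_add, div_mul_div_comm, mul_one]

theorem abs_dist_sub_pi_div_two (S : IndepHaarPair.{u, v} d) (ω : S.Ω) :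
    |S.dist ω - Real.pi / 2| = Real.arcsin (S.r ω) := by
  have h : S.dist ω = Real.pi / 2 - Real.arcsin (S.r ω) := Real.arccos_eq_pi_div_two_sub_arcsin _
  rw [h, sub_sub_cancel_left, abs_neg, abs_of_nonneg (Real.arcsin_nonneg.2 (S.r_nonneg ω))]

/-- From `sin x ≤ x`; it transfers the angular tail bound to `r`. -/
theorem r_le_abs_dist_sub_pi_div_two (S : IndepHaarPair.{u, v} d) (ω : S.Ω) :
    S.r ω ≤ |S.dist ω - Real.pi / 2| := by
  have h0 := Real.arcsin_nonneg.2 (S.r_nonneg ω)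
  calc S.r ω = Real.sin (Real.arcsin (S.r ω)) :=
        (Real.sin_arcsin (by linarith [S.r_nonneg ω]) (S.r_le_one ω)).symm
    _ ≤ Real.arcsin (S.r ω) := Real.sin_le h0
    _ = _ := (S.abs_dist_sub_pi_div_two ω).symm

/-- Concentration of the Fubini–Study distance at `π / 2`. -/
theorem measureReal_dist_tail (hd : 1 ≤ d) (S : IndepHaarPair.{u, v} d) {ε : ℝ} (hε : 0 < ε) :
    S.P.real {ω | ε < |S.dist ω - Real.pi / 2|} ≤
      2 * Real.exp (-(2 / Real.pi ^ 2) * d * ε ^ 2) := by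
  rcases le_or_gt (Real.pi / 2) ε with h | h
  · have : {ω | ε < |S.dist ω - Real.pi / 2|} = ∅ := by
      refine eq_empty_of_forall_notMem fun ω (hω : ε < _) => ?_
      rw [S.abs_dist_sub_pi_div_two] at hω
      linarith [Real.arcsin_le_pi_div_two (S.r ω)]
    rw [this, measureReal_empty]
    positivity
  obtain ⟨n, rfl⟩ : ∃ n, d = n + 1 := ⟨d - 1, by omega⟩
  have hcos : 0 < Real.cos ε := Real.cos_pos_of_mem_Ioo ⟨by linarith, h⟩
  have hsin : 2 / Real.pi * ε ≤ Real.sin ε := Real.mul_le_sin hε.le h.le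
  have hsin0 : 0 ≤ 2 / Real.pi * ε := by positivity
  have hsc := Real.sin_sq_add_cos_sq ε
  have hsub : {ω | ε < |S.dist ω - Real.pi / 2|} ⊆ {ω | Real.sin ε ^ 2 < S.r ω ^ 2} := by
    intro ω (hω : ε < _)
    rw [S.abs_dist_sub_pi_div_two] at hω
    have : Real.sin ε < S.r ω :=
      (Real.lt_arcsin_iff_sin_lt ⟨by linarith, h.le⟩
        ⟨by linarith [S.r_nonneg ω], S.r_le_one ω⟩).1 hω
    exact pow_lt_pow_left₀ this (hsin0.trans hsin) two_ne_zero
  -- Half of the lower bound `(2ε/π)²` for `sin² ε`. The spare half turns the exponent `n = d - 1`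
  -- into `d`: `-2yn = -y(n+1) + (y - yn)`, at the cost of a factor `exp y`.
  set y : ℝ := 2 * ε ^ 2 / Real.pi ^ 2 with hy
  have hy0 : 0 ≤ y := by positivity
  have h2y : 2 * y = (2 / Real.pi * ε) ^ 2 := by rw [hy]; ring
  have hysin : 2 * y ≤ Real.sin ε ^ 2 := by rw [h2y]; gcongr
  -- As `2y ≤ sin² ε ≤ 1`, one has `(exp y)² ≤ e < 4`; this is the `2` of the final bound.
  have hexp2 : Real.exp y ≤ 2 := by
    have h1 : Real.exp y ^ 2 = Real.exp (2 * y) := by rw [← Real.exp_nat_mul]; norm_num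
    have h2 : Real.exp (2 * y) ≤ Real.exp 1 := Real.exp_le_exp.2 (by nlinarith)
    have h3 := Real.exp_one_lt_d9
    nlinarith [Real.exp_pos y]
  calc S.P.real {ω | ε < |S.dist ω - Real.pi / 2|}
      ≤ S.P.real {ω | Real.sin ε ^ 2 < S.r ω ^ 2} := measureReal_mono hsub
    _ = (1 - Real.sin ε ^ 2) ^ n := by
        rw [measureReal_def, S.measure_r_sq_tail (sq_nonneg _) (by nlinarith),
          ENNReal.toReal_ofReal (pow_nonneg (by nlinarith) _)]
    _ ≤ Real.exp (-(2 * y)) ^ n := by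
        refine pow_le_pow_left₀ (by nlinarith) ?_ n
        linarith [Real.add_one_le_exp (-(2 * y))]
    _ = Real.exp (-y * (n + 1)) * Real.exp (y - y * n) := by
        rw [← Real.exp_nat_mul, ← Real.exp_add]
        ring_nf
    _ ≤ Real.exp (-y * (n + 1)) * Real.exp y := by
        gcongr
        have : 0 ≤ y * n := by positivity
        linarith
    _ ≤ Real.exp (-y * (n + 1)) * 2 := by gcongr
    _ = _ := by
        rw [mul_comm, hy]
        push_cast
        congr 2
        ring

end IndepHaarPair

end PureState

/-! ### Assembly of the theorem -/

/-- For independent Haar-random pure states in dimension `d`: the exact mean overlap, its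
asymptotics with constant `√π / 2` (and the failure of the constant `π / 4`), the law of the squared
overlap, concentration of the Fubini–Study distance at `π / 2`, and almost orthogonality. -/
theorem mainTheorem11 :
    (∀ d : ℕ, 1 ≤ d → ∀ S : PureState.IndepHaarPair.{u, v} d,
      Integrable S.r S.P ∧
      ∫ ω, S.r ω ∂S.P = Real.Gamma (3 / 2) * Real.Gamma d / Real.Gamma (d + 1 / 2)) ∧
    (∃ C : ℝ, ∀ d : ℕ, 1 ≤ d → ∀ S : PureState.IndepHaarPair.{u, v} d,
      |∫ ω, S.r ω ∂S.P - Real.sqrt Real.pi / (2 * Real.sqrt d)| ≤ C * (d : ℝ) ^ (-(3 / 2) : ℝ)) ∧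
    (∀ C : ℝ, ∃ d₀ : ℕ, ∀ d : ℕ, d₀ ≤ d → ∀ S : PureState.IndepHaarPair.{u, v} d,
      C * (d : ℝ) ^ (-(3 / 2) : ℝ) < |∫ ω, S.r ω ∂S.P - Real.pi / (4 * Real.sqrt d)|) ∧
    (∀ d : ℕ, 2 ≤ d → ∀ S : PureState.IndepHaarPair.{u, v} d,
      HasLaw (fun ω => S.r ω ^ 2) (betaMeasure 1 ((d : ℝ) - 1)) S.P) ∧
    (∃ c : ℝ, 0 < c ∧ ∀ d : ℕ, 1 ≤ d → ∀ S : PureState.IndepHaarPair.{u, v} d,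
      ∀ ε : ℝ, 0 < ε →
        S.P.real {ω | ε < |S.dist ω - Real.pi / 2|} ≤ 2 * Real.exp (-c * d * ε ^ 2)) ∧
    (∀ δ : ℝ, 0 < δ → ∃ C : ℝ, 0 < C ∧ ∀ d : ℕ, 1 ≤ d →
      ∀ S : PureState.IndepHaarPair.{u, v} d,
        S.P.real {ω | C / Real.sqrt d < S.r ω} ≤ δ) ∧
    (∀ ε : ℝ, 0 < ε → ∀ δ : ℝ, 0 < δ → ∃ d₀ : ℕ, ∀ d : ℕ, d₀ ≤ d → 1 ≤ d →
      ∀ S : PureState.IndepHaarPair.{u, v} d,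
        S.P.real {ω | ε < |S.dist ω - Real.pi / 2|} ≤ δ) := by
  have hc : 0 < 2 / Real.pi ^ 2 := by positivity
  -- the bound `2 exp (-k x)` falls below any `δ > 0`
  have hdecay : ∀ k : ℝ, 0 < k → ∀ δ : ℝ, 0 < δ →
      ∃ x₀ : ℝ, 1 ≤ x₀ ∧ ∀ x, x₀ ≤ x → 2 * Real.exp (-k * x) ≤ δ := by
    intro k hk δ hδ
    have h : Tendsto (fun x : ℝ => 2 * Real.exp (-k * x)) atTop (𝓝 (2 * 0)) :=
      (Real.tendsto_exp_atBot.comp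
        (tendsto_id.const_mul_atTop_of_neg (by linarith : -k < 0))).const_mul 2
    rw [mul_zero] at h
    obtain ⟨a, ha⟩ := eventually_atTop.1 (h.eventually (eventually_le_nhds hδ))
    exact ⟨max a 1, le_max_right _ _, fun x hx => ha x ((le_max_left _ _).trans hx)⟩
  refine ⟨fun d hd S => ⟨S.integrable_r hd, S.integral_r hd⟩,
    ⟨Real.sqrt Real.pi / 2, fun d hd S => ?_⟩, fun C => ?_, fun d hd S => ?_,
    ⟨2 / Real.pi ^ 2, hc, fun d hd S ε hε => S.measureReal_dist_tail hd hε⟩, fun δ hδ => ?_,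
    fun ε hε δ hδ => ?_⟩
  · rw [abs_of_nonneg (sub_nonneg.2 (S.inv_sqrt_le_integral_r hd))]
    linarith [S.integral_r_le hd]
  · have hsp : Real.sqrt Real.pi < 2 := by
      rw [Real.sqrt_lt' two_pos]
      linarith [Real.pi_lt_four]
    have hsp0 : 0 < Real.sqrt Real.pi := Real.sqrt_pos.2 Real.pi_pos
    have hpi : Real.sqrt Real.pi * Real.sqrt Real.pi = Real.pi := Real.mul_self_sqrt Real.pi_pos.le
    set k : ℝ := Real.sqrt Real.pi / 2 - Real.pi / 4 with hk
    have hk0 : 0 < k := by nlinarith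
    -- The gap between the constants is `k/√d = k d · d^(-3/2)`, which beats `C d^(-3/2)` once `d >
    -- C/k`; `k > 0` because `√π < 2`.
    obtain ⟨N, hN⟩ := exists_nat_gt (C / k)
    refine ⟨max N 1, fun d hd S => ?_⟩
    have hd1 : 1 ≤ d := (le_max_right _ _).trans hd
    have hd0 : (0 : ℝ) < d := by exact_mod_cast hd1
    have hNd : (N : ℝ) ≤ d := by exact_mod_cast (le_max_left _ _).trans hd
    have hs := Real.sqrt_pos.2 hd0
    have hCk : C < k * d := by
      have := (div_lt_iff₀ hk0).1 (hN.trans_le hNd)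
      linarith
    refine lt_of_lt_of_le ?_ (le_abs_self _)
    calc C * (d : ℝ) ^ (-(3 / 2) : ℝ) = C / (d * Real.sqrt d) := by rw [Real.rpow_neg_three_halves hd0, mul_one_div]
      _ < k * d / (d * Real.sqrt d) := by gcongr
      _ = Real.sqrt Real.pi / (2 * Real.sqrt d) - Real.pi / (4 * Real.sqrt d) := by
          rw [hk]
          field_simp
      _ ≤ _ := sub_le_sub_right (S.inv_sqrt_le_integral_r hd1) _
  · obtain ⟨n, rfl⟩ : ∃ n, d = n + 2 := ⟨d - 2, by omega⟩
    have h := S.hasLaw_r_sq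
    rwa [show (n : ℝ) + 1 = ((n + 2 : ℕ) : ℝ) - 1 by push_cast; ring] at h
  -- The decay threshold serves as `C`: the exponent involves `C²`, and `C² ≥ C` since `C ≥ 1`.
  · obtain ⟨C, hC1, hC⟩ := hdecay _ hc δ hδ
    refine ⟨C, by linarith, fun d hd S => ?_⟩
    have hd0 : (0 : ℝ) < d := by exact_mod_cast hd
    have hs := Real.sqrt_pos.2 hd0
    calc S.P.real {ω | C / Real.sqrt d < S.r ω}
        ≤ S.P.real {ω | C / Real.sqrt d < |S.dist ω - Real.pi / 2|} :=
          measureReal_mono fun ω (hω : _ < _) => hω.trans_le (S.r_le_abs_dist_sub_pi_div_two ω)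
      _ ≤ 2 * Real.exp (-(2 / Real.pi ^ 2) * d * (C / Real.sqrt d) ^ 2) :=
          S.measureReal_dist_tail hd (by positivity)
      _ = 2 * Real.exp (-(2 / Real.pi ^ 2) * C ^ 2) := by
          rw [div_pow, Real.sq_sqrt hd0.le, mul_assoc _ (d : ℝ), mul_div_cancel₀ _ hd0.ne']
      _ ≤ δ := hC _ (by nlinarith)
  · obtain ⟨x₀, -, hx⟩ := hdecay (2 / Real.pi ^ 2 * ε ^ 2) (by positivity) δ hδ
    obtain ⟨d₀, hd₀⟩ := exists_nat_ge x₀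
    refine ⟨d₀, fun d hd hd1 S => (S.measureReal_dist_tail hd1 hε).trans ?_⟩
    refine le_of_eq_of_le ?_ (hx d (hd₀.trans (by exact_mod_cast hd)))
    rw [neg_mul, neg_mul, neg_mul, mul_right_comm]
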